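/- For $Z>0$ let $\rho_{\mathrm{TF}}$ be the minimizer, among all $\rho\ge 0$ in $L^1(\mathbb R^3)\cap L^{5/3}(\mathbb R^3)$, of the Thomas–Fermi functional $$\mathcal E_{\mathrm{TF}}(\rho)=\int_{\mathbb R^3}\Big[\tfrac35\gamma_{\mathrm{TF}}\,\rho(x)^{5/3}-\frac{Z}{|x|}\rho(x)\Big]dx+D(\rho,\rho),\qquad \gamma_{\mathrm{TF}}=\tfrac12(3\pi^2)^{2/3},$$ where $D(\sigma,\tau)=\frac12\iint\frac{\sigma(x)\tau(y)}{|x-y|}\,dx\,dy$. Let $g\in L^2(\mathbb R^3)$ be real-valued with $\int g^2=1$, let $\delta\in\mathbb R$, put $g_R(x)=R^{-3/2}g(x/R)$ and $\rho_\delta=\rho_{\mathrm{TF}}*g_{Z^{-\delta}}^2$. For a density $\sigma\ge 0$ let $R_\sigma(x)$ be the smallest radius $R$ with $\int_{|x-y|<R}\sigma(y)\,dy=\frac12$ (and $R_\sigma(x)=\infty$ if there is no such radius), and let $$L_\sigma(x)=\int_{|x-y|<R_\sigma(x)}\frac{\sigma(y)}{|x-y|}\,dy$$ be the exchange hole potential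 of $\sigma$. There is a constant $k>0$, independent of $Z$, $\delta$, $g$ and $N$, such that for all $Z>0$ the integral defining $L_{\rho_\delta}(x)$ converges for every $x\in\mathbb R^3$, $|L_{\rho_\delta}(x)|\le kZ$ for every $x$, and in particular $$\|L_{\rho_\delta}\|_\infty\le kZ ,$$ and such that for all $N$ and all pairwise distinct points $x_1,\dots,x_N\in\mathbb R^3$ $$\sum_{1\le\mu<\nu\le N}\frac1{|x_\mu-x_\nu|}\ \ge\ \sum_{\nu=1}^N\big(\rho_\delta*|\cdot|^{-1}\big)(x_\nu)-D(\rho_\delta,\rho_\delta)-kNZ .$$ -/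

import Mathlib

open MeasureTheory
open scoped ENNReal

noncomputable section

/-- Physical space `ℝ³` with the Euclidean norm and Lebesgue measure. -/
abbrev Space3 : Type := EuclideanSpace ℝ (Fin 3)

/-- The Coulomb potential `(σ * |·|⁻¹)(x) = ∫ σ(y) / |x - y| dy`. -/
def coulombPotential (σ : Space3 → ℝ) (x : Space3) : ℝ :=
  ∫ y, σ y / ‖x - y‖

/-- The Coulomb scalar product `D(σ, τ) = (1/2) ∬ σ(x) τ(y) / |x - y| dx dy`. -/
def coulombD (σ τ : Space3 → ℝ) : ℝ :=
  (1 / 2) * ∫ x, ∫ y, σ x * τ y / ‖x - y‖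

/-- The Thomas-Fermi constant for two spin states in atomic units, `(3π²)^{2/3} / 2`. -/
def gammaTF : ℝ := (3 * Real.pi ^ 2) ^ (2 / 3 : ℝ) / 2

/-- The Thomas-Fermi functional of an atom with nuclear charge `Z`. -/
def tfFunctional (Z : ℝ) (ρ : Space3 → ℝ) : ℝ :=
  (∫ x, ((3 / 5) * gammaTF * ρ x ^ (5 / 3 : ℝ) - Z / ‖x‖ * ρ x)) + coulombD ρ ρ

/-- The domain of the Thomas-Fermi functional: nonnegative densities in `L¹ ∩ L^{5/3}`.
On it all the integrals in the functional converge absolutely. -/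
def tfDomain : Set (Space3 → ℝ) :=
  {ρ | 0 ≤ᵐ[volume] ρ ∧ Integrable ρ ∧ MemLp ρ (5 / 3 : ℝ≥0∞)}

/-- `ρ` is the Thomas-Fermi density `ρ_TF` for nuclear charge `Z`: the minimizer of the
Thomas-Fermi functional (as always for densities, up to sets of measure zero). -/
def IsTFDensity (Z : ℝ) (ρ : Space3 → ℝ) : Prop :=
  ρ ∈ tfDomain ∧ IsMinOn (tfFunctional Z) tfDomain ρ

/-- The dilated function `g_R(x) = R^{-3/2} g(R⁻¹ x)`. -/
def dilate (g : Space3 → ℝ) (R : ℝ) (x : Space3) : ℝ :=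
  R ^ (-(3 / 2) : ℝ) * g (R⁻¹ • x)

/-- The smeared density `ρ * g_R²`. -/
def smeared (ρ g : Space3 → ℝ) (R : ℝ) : Space3 → ℝ :=
  convolution ρ (fun z => dilate g R z ^ 2) (ContinuousLinearMap.mul ℝ ℝ) volume

/-- The radius `R_σ(x)` of the exchange hole: the smallest `R` for which the ball of radius `R`
around `x` carries charge `1/2`. It is `∞` if there is no such ball; the hole potential below is
then the full Coulomb potential. -/
def holeRadius (σ : Space3 → ℝ) (x : Space3) : ℝ≥0∞ :=
  sInf {R : ℝ≥0∞ | ∫ y in {y | edist x y < R}, σ y = 1 / 2}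

/-- The exchange hole of `σ` at `x`. -/
def exchangeHole (σ : Space3 → ℝ) (x : Space3) : Set Space3 :=
  {y | edist x y < holeRadius σ x}

/-- The exchange hole potential `L_σ(x) = ∫_{|x-y| < R_σ(x)} σ(y) / |x - y| dy`. -/
def holePotential (σ : Space3 → ℝ) (x : Space3) : ℝ :=
  ∫ y in exchangeHole σ x, σ y / ‖x - y‖

end

/-!
Everything rests on one estimate for `ρ_TF`: the charge within distance `1/Z` of any point `x` has a
potential of at most `const * Z` at `x` (`exists_near_bound`).

*The pointwise bound.* The minimizer satisfies `ρ_TF ≤ const * (Z / |x|)^{3/2}` almost everywhere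
(`IsTFDensity.ae_le_tfBarrier`). No Euler–Lagrange equation is needed: cutting a density down to
this barrier strictly lowers the local energy where something is cut off and does not increase the
repulsion `D`. Since `|y|^{-3/2} |x-y|⁻¹` is at most the sum of `|y|^{-5/2}` and `|x-y|^{-5/2}`, and
`|y|^{-5/2}` has integral `const * √a` over the ball of radius `a`, the choice `a = 1/Z` gives
`Z^{3/2} Z^{-1/2} = Z`. Smearing with a probability density averages translates and therefore
preserves the bound (`lintegral_smeared_mul_le`).

*The exchange hole potential.* Within distance `1/Z` the estimate above applies; farther out the
Coulomb kernel is at most `Z` and the hole carries charge at most `1/2`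
(`setIntegral_exchangeHole_le`).

*The correlation inequality.* By the Fefferman–de la Llave decomposition (`exists_ballEnergy_eq`),
`1/|x-y|` is a constant times the integral of `r⁻⁵` over all balls (of radius `r`) that contain both
`x` and `y`. In each ball, the number `n` of points and the charge `m` satisfy `n² + m² ≥ 2nm`.
Integrating this over the balls of radius more than `a = 1/(2Z)` only, the diagonal terms of `n²`
become self-energies of order `1/a`, and the missing small balls affect the interaction of a point
with charge within distance `2a = 1/Z` only, which is again controlled by the estimate above. Thus
each point costs an error of order `Z`. This part is carried out with `ℝ≥0∞`-valued integrals, so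
that all interchanges of integrals are instances of Tonelli's theorem.
-/

/-! ### The Fefferman–de la Llave decomposition of the Coulomb potential -/

theorem two_mul_le_mul_self_add_mul_self (a b : ℝ≥0∞) : 2 * (a * b) ≤ a * a + b * b := by
  rcases eq_or_ne a ⊤ with rfl | ha
  · simp
  rcases eq_or_ne b ⊤ with rfl | hb
  · simp
  lift a to NNReal using ha
  lift b to NNReal using hb
  norm_cast
  rw [← NNReal.coe_le_coe]
  push_cast
  nlinarith [sq_nonneg ((a : ℝ) - b)]

theorem lintegral_eq_mul_lintegral_comp_smul {E : Type*} [NormedAddCommGroup E]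
    [NormedSpace ℝ E] [FiniteDimensional ℝ E] [MeasurableSpace E] [BorelSpace E] (m : Measure E)
    [m.IsAddHaarMeasure] {t : ℝ} (ht : 0 < t) {f : E → ℝ≥0∞} (hf : Measurable f) :
    ∫⁻ x, f x ∂m = ENNReal.ofReal (t ^ Module.finrank ℝ E) * ∫⁻ x, f (t • x) ∂m := by
  have hm : m = ENNReal.ofReal (t ^ Module.finrank ℝ E) • m.map (t • ·) := by
    rw [Measure.map_addHaar_smul m ht.ne', smul_smul, ← ENNReal.ofReal_mul (by positivity),
      abs_of_pos (by positivity), mul_inv_cancel₀ (by positivity)]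
    simp
  conv_lhs => rw [hm]
  rw [lintegral_smul_measure, lintegral_map hf (by fun_prop), smul_eq_mul]

/-- The kernel of the Fefferman–de la Llave decomposition of the Coulomb potential: `p = (z, r)`
stands for the ball of radius `r` around `z`, and `ballKernel x p` is `r^{-5/2}` if this ball
contains `x` and `0` otherwise. The weight `r⁻⁵` of the decomposition is split evenly
between the two factors of a product of kernels. -/
@[irreducible] noncomputable def ballKernel (x : Space3) (p : Space3 × ℝ) : ℝ≥0∞ :=
  {p : Space3 × ℝ | ‖x - p.1‖ < p.2}.indicator
    (fun p => ENNReal.ofReal (p.2 ^ (-(5 / 2) : ℝ))) p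

theorem measurable_ballKernel :
    Measurable fun q : Space3 × (Space3 × ℝ) => ballKernel q.1 q.2 := by
  have hs : MeasurableSet {q : Space3 × (Space3 × ℝ) | ‖q.1 - q.2.1‖ < q.2.2} :=
    measurableSet_lt (by fun_prop) (by fun_prop)
  have : Measurable fun q : Space3 × (Space3 × ℝ) =>
      ENNReal.ofReal (q.2.2 ^ (-(5 / 2) : ℝ)) := by fun_prop
  simp only [ballKernel]
  exact this.indicator hs

@[fun_prop]
theorem measurable_ballKernel_comp {α : Type*} [MeasurableSpace α] {f : α → Space3}
    {h : α → Space3 × ℝ} (hf : Measurable f) (hh : Measurable h) :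
    Measurable fun a => ballKernel (f a) (h a) :=
  measurable_ballKernel.comp (hf.prodMk hh)

/-- The volume of the unit ball. -/
noncomputable def unitBallVolume : ℝ≥0∞ := volume (Metric.ball (0 : Space3) 1)

theorem setLIntegral_ballKernel_mul_self (x : Space3) {a : ℝ} (ha : 0 < a) :
    ∫⁻ p in {p : Space3 × ℝ | a < p.2}, ballKernel x p * ballKernel x p =
      unitBallVolume * ENNReal.ofReal a⁻¹ := by
  have hset : {p : Space3 × ℝ | a < p.2} = Set.univ ×ˢ Set.Ioi a := by ext; simp
  rw [hset, Measure.volume_eq_prod, ← Measure.prod_restrict, Measure.restrict_univ,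
    lintegral_prod_symm _ (by fun_prop)]
  have hinner : ∀ r ∈ Set.Ioi a, ∫⁻ z : Space3, ballKernel x (z, r) * ballKernel x (z, r) =
      unitBallVolume * ENNReal.ofReal (r ^ (-2 : ℝ)) := by
    intro r hr
    have hr0 : 0 < r := ha.trans hr
    have : ∀ z : Space3, ballKernel x (z, r) * ballKernel x (z, r) =
        (Metric.ball x r).indicator (fun _ => ENNReal.ofReal (r ^ (-5 : ℝ))) z := by
      intro z
      by_cases h : ‖x - z‖ < r
      · have h' : z ∈ Metric.ball x r := by rwa [Metric.mem_ball, dist_comm, dist_eq_norm]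
        rw [Set.indicator_of_mem h', ballKernel, Set.indicator_of_mem (by exact h),
          ← ENNReal.ofReal_mul (by positivity), ← Real.rpow_add hr0]
        norm_num
      · have h' : z ∉ Metric.ball x r := by rwa [Metric.mem_ball, dist_comm, dist_eq_norm]
        rw [Set.indicator_of_notMem h', ballKernel, Set.indicator_of_notMem (by exact h), zero_mul]
    simp_rw [this]
    rw [lintegral_indicator Metric.isOpen_ball.measurableSet, setLIntegral_const,
      Measure.addHaar_ball _ _ hr0.le, ← mul_assoc, ← ENNReal.ofReal_mul (by positivity),
      mul_comm, finrank_euclideanSpace_fin, unitBallVolume]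
    congr 2
    rw [← Real.rpow_natCast, ← Real.rpow_add hr0]
    norm_num
  rw [setLIntegral_congr_fun measurableSet_Ioi hinner, lintegral_const_mul _ (by fun_prop),
    ← ofReal_integral_eq_lintegral_ofReal (integrableOn_Ioi_rpow_of_lt (by norm_num) ha)
      (by
        filter_upwards [ae_restrict_mem measurableSet_Ioi] with r hr
        have : 0 < r := ha.trans hr
        simp only [Pi.zero_apply]; positivity),
    integral_Ioi_rpow_of_lt (by norm_num) ha]
  norm_num [Real.rpow_neg_one]

/-- The pair energy of the decomposition, `∬ r⁻⁵ 1[x ∈ B] 1[y ∈ B]` over all balls `B`. -/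
noncomputable def ballEnergy (x y : Space3) : ℝ≥0∞ :=
  ∫⁻ p, ballKernel x p * ballKernel y p

theorem ballKernel_add (x v z : Space3) (r : ℝ) :
    ballKernel (x + v) (z + v, r) = ballKernel x (z, r) := by
  simp [ballKernel, Set.indicator]

theorem ballKernel_isometry (A : Space3 ≃ₗᵢ[ℝ] Space3) (x z : Space3) (r : ℝ) :
    ballKernel (A x) (A z, r) = ballKernel x (z, r) := by
  simp [ballKernel, Set.indicator, ← map_sub]

theorem ballKernel_smul {t : ℝ} (ht : 0 < t) (x : Space3) (p : Space3 × ℝ) :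
    ballKernel (t • x) (t • p) = ENNReal.ofReal (t ^ (-(5 / 2) : ℝ)) * ballKernel x p := by
  obtain ⟨z, r⟩ := p
  have h : ‖t • x - t • z‖ < t * r ↔ ‖x - z‖ < r := by
    rw [← smul_sub, norm_smul, Real.norm_of_nonneg ht.le, mul_lt_mul_iff_right₀ ht]
  by_cases hr : ‖x - z‖ < r
  · have hr0 : 0 ≤ r := (norm_nonneg _).trans hr.le
    simp [ballKernel, Set.indicator, h, hr, Real.mul_rpow ht.le hr0,
      ENNReal.ofReal_mul (Real.rpow_nonneg ht.le _)]
  · simp [ballKernel, Set.indicator, h, hr]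

theorem ballEnergy_add (x y v : Space3) : ballEnergy (x + v) (y + v) = ballEnergy x y := by
  have hmp : MeasurePreserving (Prod.map (· + v) id : Space3 × ℝ → Space3 × ℝ) :=
    (measurePreserving_add_right volume v).prod (MeasurePreserving.id volume)
  rw [ballEnergy, ← hmp.lintegral_comp (by fun_prop)]
  simp [Prod.map, ballKernel_add, ballEnergy]

theorem ballEnergy_isometry (A : Space3 ≃ₗᵢ[ℝ] Space3) (x y : Space3) :
    ballEnergy (A x) (A y) = ballEnergy x y := by
  have hmp : MeasurePreserving (Prod.map A id : Space3 × ℝ → Space3 × ℝ) :=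
    A.measurePreserving.prod (MeasurePreserving.id volume)
  rw [ballEnergy, ← hmp.lintegral_comp (by fun_prop)]
  simp [Prod.map, ballKernel_isometry, ballEnergy]

theorem ballEnergy_smul {t : ℝ} (ht : 0 < t) (x y : Space3) :
    ballEnergy (t • x) (t • y) = ENNReal.ofReal t⁻¹ * ballEnergy x y := by
  have : (volume : Measure (Space3 × ℝ)).IsAddHaarMeasure :=
    Measure.prod.instIsAddHaarMeasure volume volume
  have hdim : Module.finrank ℝ (Space3 × ℝ) = 4 := by simp
  rw [ballEnergy, lintegral_eq_mul_lintegral_comp_smul volume ht (by fun_prop), hdim]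
  simp_rw [ballKernel_smul ht]
  have : ∀ p, ENNReal.ofReal (t ^ (-(5 / 2) : ℝ)) * ballKernel x p *
      (ENNReal.ofReal (t ^ (-(5 / 2) : ℝ)) * ballKernel y p) =
      ENNReal.ofReal (t ^ (-5 : ℝ)) * (ballKernel x p * ballKernel y p) := by
    intro p
    rw [mul_mul_mul_comm, ← ENNReal.ofReal_mul (by positivity), ← Real.rpow_add ht]
    norm_num
  simp_rw [this]
  rw [lintegral_const_mul _ (by fun_prop), ← mul_assoc,
    ← ENNReal.ofReal_mul (by positivity), ← Real.rpow_natCast, ← Real.rpow_add ht]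
  norm_num [Real.rpow_neg_one, ballEnergy]

theorem ballKernel_mul_eq_zero {x y : Space3} {p : Space3 × ℝ} (h : 2 * p.2 ≤ ‖x - y‖) :
    ballKernel x p * ballKernel y p = 0 := by
  by_contra hne
  have hx : ‖x - p.1‖ < p.2 := by
    by_contra hx; exact hne (by simp [ballKernel, Set.indicator, hx])
  have hy : ‖y - p.1‖ < p.2 := by
    by_contra hy; exact hne (by simp [ballKernel, Set.indicator, hy])
  have := norm_sub_le_norm_sub_add_norm_sub x p.1 y
  rw [norm_sub_rev p.1 y] at this
  linarith

theorem ballEnergy_ne_zero (x y : Space3) : ballEnergy x y ≠ 0 := by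
  have hopen : IsOpen {p : Space3 × ℝ | ‖x - p.1‖ < p.2 ∧ ‖y - p.1‖ < p.2} := by
    rw [Set.ofPred_and]
    exact (isOpen_lt (by fun_prop) (by fun_prop)).inter (isOpen_lt (by fun_prop) (by fun_prop))
  have hpos : 0 < volume {p : Space3 × ℝ | ‖x - p.1‖ < p.2 ∧ ‖y - p.1‖ < p.2} := by
    refine hopen.measure_pos _ ⟨(x, ‖y - x‖ + 1), ?_⟩
    simp only [Set.mem_ofPred_eq, sub_self, norm_zero]
    exact ⟨by positivity, by linarith⟩
  rw [ballEnergy, ← pos_iff_ne_zero, lintegral_pos_iff_support (by fun_prop)]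
  refine hpos.trans_le (measure_mono fun p hp => ?_)
  obtain ⟨h1, h2⟩ := hp
  have hp0 : 0 < p.2 := (norm_nonneg _).trans_lt h1
  simp [ballKernel, Set.indicator, h1, h2, Real.rpow_pos_of_pos hp0]

theorem ballEnergy_ne_top {x y : Space3} (h : x ≠ y) : ballEnergy x y ≠ ⊤ := by
  have hd : 0 < ‖x - y‖ / 2 := half_pos (norm_sub_pos_iff.2 h)
  have hle : ballEnergy x y ≤
      ∫⁻ p in {p : Space3 × ℝ | ‖x - y‖ / 2 < p.2},
        (ballKernel x p * ballKernel x p + ballKernel y p * ballKernel y p) := by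
    rw [ballEnergy, ← lintegral_indicator (measurableSet_lt (by fun_prop) (by fun_prop))]
    refine lintegral_mono fun p => ?_
    by_cases hp : ‖x - y‖ / 2 < p.2
    · rw [Set.indicator_of_mem (by exact hp)]
      refine le_trans ?_ (two_mul_le_mul_self_add_mul_self _ _)
      rw [two_mul]; exact le_self_add
    · rw [ballKernel_mul_eq_zero (by linarith)]; exact zero_le
  refine ne_top_of_le_ne_top ?_ hle
  rw [lintegral_add_left (by fun_prop), setLIntegral_ballKernel_mul_self _ hd,
    setLIntegral_ballKernel_mul_self _ hd]
  have : unitBallVolume ≠ ⊤ := measure_ball_lt_top.ne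
  finiteness

/-- The Fefferman–de la Llave decomposition of the Coulomb potential: up to a constant, `1/|x-y|`
is the `r⁻⁵`-weighted measure of the balls that contain both `x` and `y`. The two sides have the
same behaviour under translations, rotations and dilations, which determines them up to the
constant. -/
theorem exists_ballEnergy_eq :
    ∃ C : ℝ≥0∞, C ≠ 0 ∧ C ≠ ⊤ ∧ ∀ x y, ballEnergy x y = C * ‖x - y‖ₑ⁻¹ := by
  let e : Space3 := EuclideanSpace.single 0 1
  have he : ‖e‖ = 1 := by simp [e]
  have he0 : e ≠ 0 := by rw [← norm_pos_iff, he]; exact one_pos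
  refine ⟨ballEnergy e 0, ballEnergy_ne_zero _ _, ballEnergy_ne_top he0, fun x y => ?_⟩
  have h1 : ballEnergy x y = ballEnergy (x - y) 0 := by
    simpa using ballEnergy_add (x - y) 0 y
  rw [h1]
  generalize x - y = d
  rcases eq_or_ne d 0 with rfl | hd
  -- On the diagonal both sides are infinite: the energy is nonzero and invariant under halving.
  · have h2 := ballEnergy_smul (t := 2) two_pos 0 0
    have h0 := ballEnergy_ne_zero 0 0
    have : ballEnergy 0 0 = ⊤ := by
      by_contra htop
      rw [smul_zero] at h2
      have h3 := congrArg ENNReal.toReal h2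
      rw [ENNReal.toReal_mul, ENNReal.toReal_ofReal (by norm_num)] at h3
      have h4 : 0 < (ballEnergy 0 0).toReal := ENNReal.toReal_pos h0 htop
      linarith
    rw [this]
    simp [ENNReal.mul_top, ballEnergy_ne_zero]
  -- A reflection maps `|d| e` to `d`, and scaling reduces `|d| e` to `e`.
  · have hd' : 0 < ‖d‖ := norm_pos_iff.2 hd
    have hn : ‖‖d‖ • e‖ = ‖d‖ := by rw [norm_smul, he, norm_norm, mul_one]
    have h3 := ballEnergy_isometry (Submodule.reflection (ℝ ∙ (‖d‖ • e - d))ᗮ) (‖d‖ • e) 0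
    rw [Submodule.reflection_sub hn, map_zero] at h3
    have h4 := ballEnergy_smul hd' e 0
    rw [smul_zero] at h4
    rw [h3, h4, mul_comm, ENNReal.ofReal_inv_of_pos hd', ofReal_norm]

/-! ### Onsager's correlation inequality -/

/-- Locality: balls of radius at most `a` contribute to the pair energy of `x` and `y` only if
`|x - y| < 2a`. -/
theorem ballEnergy_le (x y : Space3) (a : ℝ) :
    ballEnergy x y ≤ (∫⁻ p in {p : Space3 × ℝ | a < p.2}, ballKernel x p * ballKernel y p) +
      (Metric.ball x (2 * a)).indicator (fun y => ballEnergy x y) y := by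
  by_cases h : y ∈ Metric.ball x (2 * a)
  · rw [Set.indicator_of_mem h]; exact le_add_self
  · rw [Set.indicator_of_notMem h, add_zero, ballEnergy,
      ← lintegral_indicator (measurableSet_lt (by fun_prop) (by fun_prop))]
    refine lintegral_mono fun p => ?_
    by_cases hp : a < p.2
    · rw [Set.indicator_of_mem (by exact hp)]
    · rw [Metric.mem_ball, dist_comm, dist_eq_norm] at h
      rw [ballKernel_mul_eq_zero (by linarith)]; exact zero_le

/-- The charge of the density `s` in a ball, weighted by `r^{-5/2}`. -/
noncomputable def ballCharge (s : Space3 → ℝ≥0∞) (p : Space3 × ℝ) : ℝ≥0∞ :=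
  ∫⁻ y, s y * ballKernel y p

theorem lintegral_ballKernel_mul_ballCharge {s : Space3 → ℝ≥0∞} (hs : Measurable s) (x : Space3)
    (A : Set (Space3 × ℝ)) :
    ∫⁻ p in A, ballKernel x p * ballCharge s p =
      ∫⁻ y, s y * ∫⁻ p in A, ballKernel x p * ballKernel y p := by
  have h1 : ∀ p, ballKernel x p * ballCharge s p =
      ∫⁻ y, s y * (ballKernel x p * ballKernel y p) := by
    intro p
    rw [ballCharge, ← lintegral_const_mul _ (by fun_prop)]
    refine lintegral_congr fun y => ?_
    ring
  simp_rw [h1]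
  rw [lintegral_lintegral_swap (by fun_prop)]
  refine lintegral_congr fun y => ?_
  rw [lintegral_const_mul _ (by fun_prop)]

theorem measurable_ballCharge {s : Space3 → ℝ≥0∞} (hs : Measurable s) :
    Measurable (ballCharge s) := by
  unfold ballCharge
  exact Measurable.lintegral_prod_right (by fun_prop)

theorem measurable_ballEnergy : Measurable fun q : Space3 × Space3 => ballEnergy q.1 q.2 := by
  unfold ballEnergy
  exact Measurable.lintegral_prod_right (by fun_prop)

theorem measurable_ballEnergy_right (x : Space3) : Measurable fun y => ballEnergy x y :=
  measurable_ballEnergy.comp (by fun_prop : Measurable fun y : Space3 => (x, y))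

theorem lintegral_ballCharge_mul_self {s : Space3 → ℝ≥0∞} (hs : Measurable s) :
    ∫⁻ p, ballCharge s p * ballCharge s p = ∫⁻ x, ∫⁻ y, s x * s y * ballEnergy x y := by
  have hq := measurable_ballCharge hs
  have h1 : ∀ p, ballCharge s p * ballCharge s p =
      ∫⁻ x, s x * (ballKernel x p * ballCharge s p) := by
    intro p
    conv_lhs => enter [1]; rw [ballCharge]
    rw [← lintegral_mul_const _ (by fun_prop)]
    refine lintegral_congr fun y => ?_
    ring
  simp_rw [h1]
  rw [lintegral_lintegral_swap (by fun_prop)]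
  refine lintegral_congr fun x => ?_
  rw [lintegral_const_mul _ (by fun_prop)]
  have h2 := lintegral_ballKernel_mul_ballCharge hs x Set.univ
  rw [setLIntegral_univ] at h2
  rw [h2, ← lintegral_const_mul _ (by
    have := measurable_ballEnergy_right x
    simp only [setLIntegral_univ]
    exact hs.mul this)]
  refine lintegral_congr fun y => ?_
  rw [setLIntegral_univ, ballEnergy, mul_assoc]

/-- Onsager's electrostatic inequality in terms of the ball energies. In each ball of radius more
than `a` the number `n` of points and the charge `m` satisfy `2nm ≤ n² + m²`. The diagonal terms
of `n²` are finite self-energies thanks to the cutoff `a`, and by locality the cutoff removes from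
the interaction of a point with the charge only what is within distance `2a`. -/
theorem two_mul_sum_ballEnergy_le {s : Space3 → ℝ≥0∞} (hs : Measurable s) {a : ℝ} (ha : 0 < a)
    {N : ℕ} (x : Fin N → Space3) :
    2 * ∑ ν, ∫⁻ y, s y * ballEnergy (x ν) y ≤
      (∑ ν, ∑ μ ∈ Finset.univ.erase ν, ballEnergy (x ν) (x μ)) +
        N * (unitBallVolume * ENNReal.ofReal a⁻¹) +
        (∫⁻ x, ∫⁻ y, s x * s y * ballEnergy x y) +
        2 * ∑ ν, ∫⁻ y in Metric.ball (x ν) (2 * a), s y * ballEnergy (x ν) y := by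
  have hq := measurable_ballCharge hs
  set A : Set (Space3 × ℝ) := {p | a < p.2}
  have hpoint : ∀ p, 2 * ((∑ ν, ballKernel (x ν) p) * ballCharge s p) ≤
      (∑ ν, ballKernel (x ν) p) * (∑ ν, ballKernel (x ν) p) +
        ballCharge s p * ballCharge s p := fun p => two_mul_le_mul_self_add_mul_self _ _
  have hint : ∫⁻ p in A, 2 * ((∑ ν, ballKernel (x ν) p) * ballCharge s p) ≤
      ∫⁻ p in A, ((∑ ν, ballKernel (x ν) p) * (∑ ν, ballKernel (x ν) p) +
        ballCharge s p * ballCharge s p) := lintegral_mono hpoint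
  rw [lintegral_add_right _ (by fun_prop), lintegral_const_mul _ (by fun_prop)] at hint
  have hcross : ∫⁻ p in A, (∑ ν, ballKernel (x ν) p) * ballCharge s p =
      ∑ ν, ∫⁻ p in A, ballKernel (x ν) p * ballCharge s p := by
    simp_rw [Finset.sum_mul]
    exact lintegral_finsetSum _ fun ν _ => by fun_prop
  have hself : ∫⁻ p in A, (∑ ν, ballKernel (x ν) p) * (∑ ν, ballKernel (x ν) p) ≤
      (∑ ν, ∑ μ ∈ Finset.univ.erase ν, ballEnergy (x ν) (x μ)) +
        N * (unitBallVolume * ENNReal.ofReal a⁻¹) := by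
    simp_rw [Finset.sum_mul_sum]
    rw [lintegral_finsetSum _ fun ν _ => by fun_prop]
    have hν : ∀ ν, ∫⁻ p in A, ∑ μ, ballKernel (x ν) p * ballKernel (x μ) p ≤
        (∑ μ ∈ Finset.univ.erase ν, ballEnergy (x ν) (x μ)) +
          unitBallVolume * ENNReal.ofReal a⁻¹ := by
      intro ν
      rw [lintegral_finsetSum _ fun μ _ => by fun_prop,
        ← Finset.sum_erase_add _ _ (Finset.mem_univ ν),
        setLIntegral_ballKernel_mul_self _ ha]
      gcongr
      exact setLIntegral_le_lintegral _ _
    refine (Finset.sum_le_sum fun ν _ => hν ν).trans ?_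
    rw [Finset.sum_add_distrib]
    simp
  have hV : ∀ ν, ∫⁻ y, s y * ballEnergy (x ν) y ≤
      (∫⁻ p in A, ballKernel (x ν) p * ballCharge s p) +
        ∫⁻ y in Metric.ball (x ν) (2 * a), s y * ballEnergy (x ν) y := by
    intro ν
    have hms : Measurable ((Metric.ball (x ν) (2 * a)).indicator
        fun y => s y * ballEnergy (x ν) y) :=
      (hs.mul (measurable_ballEnergy_right _)).indicator Metric.isOpen_ball.measurableSet
    rw [lintegral_ballKernel_mul_ballCharge hs,
      ← lintegral_indicator Metric.isOpen_ball.measurableSet, ← lintegral_add_right _ hms]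
    refine lintegral_mono fun y => ?_
    refine (mul_le_mul_right (ballEnergy_le (x ν) y a) (s y)).trans (le_of_eq ?_)
    rw [mul_add]
    congr 1
    by_cases h : y ∈ Metric.ball (x ν) (2 * a) <;> simp [h]
  calc 2 * ∑ ν, ∫⁻ y, s y * ballEnergy (x ν) y
      ≤ 2 * ∑ ν, ((∫⁻ p in A, ballKernel (x ν) p * ballCharge s p) +
        ∫⁻ y in Metric.ball (x ν) (2 * a), s y * ballEnergy (x ν) y) := by
        gcongr with ν _; exact hV ν
    _ = 2 * (∫⁻ p in A, (∑ ν, ballKernel (x ν) p) * ballCharge s p) +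
        2 * ∑ ν, ∫⁻ y in Metric.ball (x ν) (2 * a), s y * ballEnergy (x ν) y := by
        rw [hcross, Finset.sum_add_distrib, mul_add]
    _ ≤ _ := by
        gcongr
        refine hint.trans (add_le_add hself ?_)
        rw [← lintegral_ballCharge_mul_self hs]
        exact setLIntegral_le_lintegral _ _

theorem sum_erase_eq_two_mul_sum_lt {N : ℕ} (f : Fin N → Fin N → ℝ≥0∞)
    (hf : ∀ μ ν, f μ ν = f ν μ) :
    ∑ ν, ∑ μ ∈ Finset.univ.erase ν, f ν μ =
      2 * ∑ ν, ∑ μ ∈ Finset.univ.filter (fun μ => μ < ν), f μ ν := by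
  have hsplit : ∀ ν, ∑ μ ∈ Finset.univ.erase ν, f ν μ =
      (∑ μ, if μ < ν then f μ ν else 0) + ∑ μ, if ν < μ then f ν μ else 0 := by
    intro ν
    rw [← Finset.sum_add_distrib, ← Finset.sum_erase_add _ _ (Finset.mem_univ ν)]
    simp only [lt_irrefl, if_false, add_zero]
    refine Finset.sum_congr rfl fun μ hμ => ?_
    rcases lt_or_gt_of_ne (Finset.ne_of_mem_erase hμ) with h | h
    · simp [h, h.not_gt, hf]
    · simp [h, h.not_gt]
  simp_rw [hsplit, Finset.sum_filter]
  rw [Finset.sum_add_distrib, two_mul, Finset.sum_comm (f := fun ν μ => if ν < μ then f ν μ else 0)]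

/-- Onsager's lower bound on the Coulomb repulsion of distinct points by their interaction with a
charge density `s`, with extended-valued terms. -/
theorem exists_correlation_bound :
    ∃ c : ℝ≥0∞, c ≠ ⊤ ∧ ∀ s : Space3 → ℝ≥0∞, AEMeasurable s → ∀ a : ℝ, 0 < a →
      ∀ (N : ℕ) (x : Fin N → Space3),
      2 * ∑ ν, ∫⁻ y, s y * ‖x ν - y‖ₑ⁻¹ ≤
        2 * (∑ ν, ∑ μ ∈ Finset.univ.filter (fun μ => μ < ν), ‖x μ - x ν‖ₑ⁻¹) +
          N * (c * ENNReal.ofReal a⁻¹) +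
          (∫⁻ x, ∫⁻ y, s x * s y * ‖x - y‖ₑ⁻¹) +
          2 * ∑ ν, ∫⁻ y in Metric.ball (x ν) (2 * a), s y * ‖x ν - y‖ₑ⁻¹ := by
  obtain ⟨C, hC0, hCt, hC⟩ := exists_ballEnergy_eq
  have hvol : unitBallVolume ≠ ⊤ := measure_ball_lt_top.ne
  refine ⟨C⁻¹ * unitBallVolume, by finiteness, fun s hs a ha N x => ?_⟩
  -- The integrals do not change when `s` is replaced by a measurable representative.
  wlog hm : Measurable s generalizing s
  · have h := this hs.mk hs.measurable_mk.aemeasurable hs.measurable_mk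
    have e := hs.ae_eq_mk
    have e1 : ∀ x, ∀ᵐ y, s y * ‖x - y‖ₑ⁻¹ = hs.mk s y * ‖x - y‖ₑ⁻¹ := fun x => by
      filter_upwards [e] with y hy; rw [hy]
    have e2 : ∀ x t, ∀ᵐ y, t * s y * ‖x - y‖ₑ⁻¹ = t * hs.mk s y * ‖x - y‖ₑ⁻¹ := fun x t => by
      filter_upwards [e] with y hy; rw [hy]
    have e3 : ∀ᵐ x, ∫⁻ y, s x * s y * ‖x - y‖ₑ⁻¹ = ∫⁻ y, hs.mk s x * hs.mk s y * ‖x - y‖ₑ⁻¹ := by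
      filter_upwards [e] with x hx
      rw [lintegral_congr_ae (e2 x (s x)), hx]
    simp_rw [fun ν => lintegral_congr_ae (e1 (x ν)),
      fun ν => lintegral_congr_ae (ae_restrict_of_ae (s := Metric.ball (x ν) (2 * a)) (e1 (x ν)))]
    rwa [lintegral_congr_ae e3]
  have hx : Measurable fun q : Space3 × Space3 => ‖q.1 - q.2‖ₑ⁻¹ := by fun_prop
  have h := two_mul_sum_ballEnergy_le hm ha x
  rw [sum_erase_eq_two_mul_sum_lt _ fun μ ν => by rw [hC, hC, enorm_sub_rev]] at h
  simp_rw [hC] at h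
  have k1 : ∀ x (m : Measure Space3), ∫⁻ y, s y * (C * ‖x - y‖ₑ⁻¹) ∂m =
      C * ∫⁻ y, s y * ‖x - y‖ₑ⁻¹ ∂m := fun x m => by
    rw [← lintegral_const_mul _ (by fun_prop)]
    exact lintegral_congr fun y => by ring
  have k2 : ∫⁻ x, ∫⁻ y, s x * s y * (C * ‖x - y‖ₑ⁻¹) =
      C * ∫⁻ x, ∫⁻ y, s x * s y * ‖x - y‖ₑ⁻¹ := by
    rw [← lintegral_const_mul _ (Measurable.lintegral_prod_right (by fun_prop))]
    refine lintegral_congr fun x => ?_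
    rw [← lintegral_const_mul _ (by fun_prop)]
    exact lintegral_congr fun y => by ring
  simp_rw [k1, k2, ← Finset.mul_sum] at h
  have hc : unitBallVolume = C * (C⁻¹ * unitBallVolume) := by
    rw [← mul_assoc, ENNReal.mul_inv_cancel hC0 hCt, one_mul]
  rw [hc] at h
  rw [← ENNReal.mul_le_mul_iff_right hC0 hCt]
  convert h using 1 <;> ring

/-! ### Singular integrals over small balls -/

/-- The integral of `|y|^{-5/2}` over the unit ball. -/
noncomputable def singularMass : ℝ≥0∞ :=
  ∫⁻ y in Metric.ball (0 : Space3) 1, ENNReal.ofReal (‖y‖ ^ (-(5 / 2) : ℝ))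

theorem singularMass_ne_top : singularMass ≠ ⊤ := by
  have h : IntegrableOn (fun y : Space3 => ‖y‖ ^ (-(5 / 2) : ℝ)) (Metric.ball 0 1) := by
    rw [integrableOn_fun_norm_addHaar volume (f := fun r : ℝ => r ^ (-(5 / 2) : ℝ))]
    have h1 : IntegrableOn (fun r : ℝ => r ^ (-(1 / 2) : ℝ)) (Set.Ioo 0 1) :=
      (intervalIntegral.integrableOn_Ioo_rpow_iff one_pos).2 (by norm_num)
    refine h1.congr_fun (fun r hr => ?_) measurableSet_Ioo
    simp only [finrank_euclideanSpace_fin, smul_eq_mul]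
    rw [← Real.rpow_natCast, ← Real.rpow_add hr.1]
    norm_num
  exact h.lintegral_lt_top.ne

theorem setLIntegral_ball_norm_rpow {a : ℝ} (ha : 0 < a) :
    ∫⁻ y in Metric.ball (0 : Space3) a, ENNReal.ofReal (‖y‖ ^ (-(5 / 2) : ℝ)) =
      ENNReal.ofReal (a ^ (1 / 2 : ℝ)) * singularMass := by
  have hf : Measurable fun y : Space3 => ENNReal.ofReal (‖y‖ ^ (-(5 / 2) : ℝ)) := by fun_prop
  rw [singularMass, ← lintegral_indicator Metric.isOpen_ball.measurableSet,
    ← lintegral_indicator Metric.isOpen_ball.measurableSet,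
    lintegral_eq_mul_lintegral_comp_smul volume ha
      (hf.indicator Metric.isOpen_ball.measurableSet)]
  have h : ∀ y : Space3, (Metric.ball (0 : Space3) a).indicator
      (fun y => ENNReal.ofReal (‖y‖ ^ (-(5 / 2) : ℝ))) (a • y) =
      ENNReal.ofReal (a ^ (-(5 / 2) : ℝ)) * (Metric.ball (0 : Space3) 1).indicator
      (fun y => ENNReal.ofReal (‖y‖ ^ (-(5 / 2) : ℝ))) y := by
    intro y
    have hmem : a • y ∈ Metric.ball (0 : Space3) a ↔ y ∈ Metric.ball (0 : Space3) 1 := by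
      simp only [mem_ball_zero_iff, norm_smul, Real.norm_of_nonneg ha.le]
      exact mul_lt_iff_lt_one_right ha
    by_cases hy : y ∈ Metric.ball (0 : Space3) 1
    · rw [Set.indicator_of_mem (hmem.2 hy), Set.indicator_of_mem hy,
        ← ENNReal.ofReal_mul (by positivity), norm_smul, Real.norm_of_nonneg ha.le,
        Real.mul_rpow ha.le (norm_nonneg _)]
    · rw [Set.indicator_of_notMem (mt hmem.1 hy), Set.indicator_of_notMem hy, mul_zero]
  simp_rw [h]
  rw [lintegral_const_mul _ (hf.indicator Metric.isOpen_ball.measurableSet), ← mul_assoc,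
    ← ENNReal.ofReal_mul (by positivity), finrank_euclideanSpace_fin, ← Real.rpow_natCast,
    ← Real.rpow_add ha]
  norm_num

theorem rpow_mul_inv_le_left {p q : ℝ} (hp : 0 < p) (h : p ≤ q) :
    p ^ (-(3 / 2) : ℝ) * q⁻¹ ≤ p ^ (-(5 / 2) : ℝ) := by
  have : p ^ (-(5 / 2) : ℝ) = p ^ (-(3 / 2) : ℝ) * p⁻¹ := by
    rw [← Real.rpow_neg_one, ← Real.rpow_add hp]; norm_num
  rw [this]
  gcongr

theorem rpow_mul_inv_le_right {p q : ℝ} (hq : 0 < q) (h : q ≤ p) :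
    p ^ (-(3 / 2) : ℝ) * q⁻¹ ≤ q ^ (-(5 / 2) : ℝ) := by
  have : q ^ (-(5 / 2) : ℝ) = q ^ (-(3 / 2) : ℝ) * q⁻¹ := by
    rw [← Real.rpow_neg_one, ← Real.rpow_add hq]; norm_num
  rw [this]
  gcongr ?_ * _
  exact Real.rpow_le_rpow_of_nonpos hq h (by norm_num)

theorem enorm_inv_eq_ofReal {x y : Space3} (h : y ≠ x) :
    ‖x - y‖ₑ⁻¹ = ENNReal.ofReal ‖x - y‖⁻¹ := by
  rw [ENNReal.ofReal_inv_of_pos (norm_sub_pos_iff.2 h.symm), ofReal_norm]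

/-- The part within distance `a` of `x` of the Coulomb potential of `|y|^{-3/2}` is of order
`√a`, uniformly in `x`: `|y|^{-3/2} |x-y|⁻¹` is at most the `-5/2` power of the smaller of the two
distances. -/
theorem setLIntegral_ball_coulomb_le (x : Space3) {a : ℝ} (ha : 0 < a) :
    ∫⁻ y in Metric.ball x a, ENNReal.ofReal (‖y‖ ^ (-(3 / 2) : ℝ)) * ‖x - y‖ₑ⁻¹ ≤
      2 * (ENNReal.ofReal (a ^ (1 / 2 : ℝ)) * singularMass) := by
  set F : Space3 → ℝ≥0∞ := (Metric.ball (0 : Space3) a).indicator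
      (fun y => ENNReal.ofReal (‖y‖ ^ (-(5 / 2) : ℝ))) with hF
  have hFm : Measurable F :=
    Measurable.indicator (by fun_prop) Metric.isOpen_ball.measurableSet
  have hFi : ∫⁻ y, F y = ENNReal.ofReal (a ^ (1 / 2 : ℝ)) * singularMass := by
    rw [hF, lintegral_indicator Metric.isOpen_ball.measurableSet, setLIntegral_ball_norm_rpow ha]
  have hFx : ∫⁻ y, F (x - y) = ENNReal.ofReal (a ^ (1 / 2 : ℝ)) * singularMass := by
    rw [lintegral_sub_left_eq_self F x, hFi]
  calc ∫⁻ y in Metric.ball x a, ENNReal.ofReal (‖y‖ ^ (-(3 / 2) : ℝ)) * ‖x - y‖ₑ⁻¹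
      ≤ ∫⁻ y, (F y + F (x - y)) := by
        rw [← lintegral_indicator Metric.isOpen_ball.measurableSet]
        refine lintegral_mono_ae ?_
        filter_upwards [volume.ae_ne x, volume.ae_ne 0] with y hyx hy0
        by_cases hy : y ∈ Metric.ball x a
        · have hy' : ‖x - y‖ < a := by rwa [Metric.mem_ball, dist_comm, dist_eq_norm] at hy
          have hq : 0 < ‖x - y‖ := norm_sub_pos_iff.2 hyx.symm
          have hp : 0 < ‖y‖ := norm_pos_iff.2 hy0
          rw [Set.indicator_of_mem hy, enorm_inv_eq_ofReal hyx,
            ← ENNReal.ofReal_mul (by positivity)]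
          rcases le_total ‖y‖ ‖x - y‖ with h | h
          · refine le_trans ?_ le_self_add
            rw [hF, Set.indicator_of_mem (mem_ball_zero_iff.2 (h.trans_lt hy'))]
            exact ENNReal.ofReal_le_ofReal (rpow_mul_inv_le_left hp h)
          · refine le_trans ?_ le_add_self
            rw [hF, Set.indicator_of_mem (mem_ball_zero_iff.2 hy')]
            exact ENNReal.ofReal_le_ofReal (rpow_mul_inv_le_right hq h)
        · rw [Set.indicator_of_notMem hy]; exact zero_le
    _ = _ := by rw [lintegral_add_left hFm, hFi, hFx, two_mul]

theorem div_le_add_rpow_add {r d : ℝ} (hr : 0 ≤ r) (hd : 0 < d) :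
    r * d⁻¹ ≤ r ^ (5 / 3 : ℝ) + d ^ (-(5 / 2) : ℝ) := by
  rcases hr.eq_or_lt with rfl | hr
  · rw [zero_mul]; positivity
  rcases le_total d⁻¹ (r ^ (2 / 3 : ℝ)) with h | h
  · have : r ^ (5 / 3 : ℝ) = r * r ^ (2 / 3 : ℝ) := by
      rw [← Real.rpow_one_add' hr.le (by norm_num)]; norm_num
    have h2 : r * d⁻¹ ≤ r * r ^ (2 / 3 : ℝ) := by gcongr
    have : 0 ≤ d ^ (-(5 / 2) : ℝ) := by positivity
    linarith
  · have h1 : r ≤ d ^ (-(3 / 2) : ℝ) := by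
      have := Real.rpow_le_rpow (by positivity) h (by norm_num : (0 : ℝ) ≤ 3 / 2)
      rwa [← Real.rpow_mul hr.le, Real.inv_rpow hd.le, ← Real.rpow_neg hd.le,
        show (2 / 3 : ℝ) * (3 / 2) = 1 by norm_num, Real.rpow_one] at this
    have h2 : r * d⁻¹ ≤ d ^ (-(3 / 2) : ℝ) * d⁻¹ := by gcongr
    have h3 := rpow_mul_inv_le_left hd le_rfl
    have : 0 ≤ r ^ (5 / 3 : ℝ) := by positivity
    linarith

/-! ### Coulomb potentials and energies of densities -/

theorem integrable_rpow_of_mem_tfDomain {ρ : Space3 → ℝ} (h : ρ ∈ tfDomain) :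
    Integrable fun x => ρ x ^ (5 / 3 : ℝ) := by
  obtain ⟨h0, -, h2⟩ := h
  have h3 := h2.integrable_norm_rpow (by simp) (by finiteness)
  rw [ENNReal.toReal_div] at h3
  refine h3.congr ?_
  filter_upwards [h0] with x hx
  rw [Real.norm_of_nonneg hx]
  norm_num

/-- The Coulomb potential of a density in `L¹ ∩ L^{5/3}` is bounded. -/
theorem exists_coulomb_le {ρ : Space3 → ℝ} (h : ρ ∈ tfDomain) :
    ∃ M : ℝ≥0∞, M ≠ ⊤ ∧ ∀ x, ∫⁻ y, ENNReal.ofReal (ρ y) * ‖x - y‖ₑ⁻¹ ≤ M := by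
  -- Within distance `1`, `r / d ≤ r^{5/3} + d^{-5/2}`; farther out the kernel is at most `1`.
  have h53 := integrable_rpow_of_mem_tfDomain h
  obtain ⟨h0, h1, h2⟩ := h
  refine ⟨(∫⁻ y, ENNReal.ofReal (ρ y)) + (∫⁻ y, ENNReal.ofReal (ρ y ^ (5 / 3 : ℝ))) +
    singularMass, ?_, fun x => ?_⟩
  · have := h1.lintegral_lt_top.ne
    have := h53.lintegral_lt_top.ne
    have := singularMass_ne_top
    finiteness
  set F : Space3 → ℝ≥0∞ := (Metric.ball (0 : Space3) 1).indicator
      (fun y => ENNReal.ofReal (‖y‖ ^ (-(5 / 2) : ℝ))) with hF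
  have hFm : Measurable F :=
    Measurable.indicator (by fun_prop) Metric.isOpen_ball.measurableSet
  have hFx : ∫⁻ y, F (x - y) = singularMass := by
    rw [lintegral_sub_left_eq_self F x, hF, lintegral_indicator Metric.isOpen_ball.measurableSet,
      singularMass]
  rw [← hFx, ← lintegral_add_right' _ h53.aemeasurable.ennreal_ofReal,
    ← lintegral_add_right _ (by fun_prop)]
  refine lintegral_mono_ae ?_
  filter_upwards [h0, volume.ae_ne x] with y hy hyx
  have hd : 0 < ‖x - y‖ := norm_sub_pos_iff.2 hyx.symm
  rw [enorm_inv_eq_ofReal hyx, ← ENNReal.ofReal_mul hy]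
  by_cases h1 : ‖x - y‖ < 1
  · rw [hF, Set.indicator_of_mem (mem_ball_zero_iff.2 h1), add_assoc,
      ← ENNReal.ofReal_add (Real.rpow_nonneg hy _) (by positivity)]
    exact (ENNReal.ofReal_le_ofReal (div_le_add_rpow_add hy hd)).trans le_add_self
  · rw [add_assoc]
    refine (ENNReal.ofReal_le_ofReal ?_).trans le_self_add
    exact mul_le_of_le_one_right hy (inv_le_one_of_one_le₀ (not_lt.1 h1))

theorem integrable_div_norm {σ : Space3 → ℝ} {m : Measure Space3} (hσ : AEStronglyMeasurable σ m)
    (h0 : 0 ≤ᵐ[m] σ) {x : Space3} (h : ∫⁻ y, ENNReal.ofReal (σ y) * ‖x - y‖ₑ⁻¹ ∂m ≠ ⊤) :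
    Integrable (fun y => σ y / ‖x - y‖) m := by
  refine ⟨hσ.div₀ (by fun_prop), ?_⟩
  refine lt_of_le_of_lt (lintegral_mono_ae ?_) (lt_top_iff_ne_top.2 h)
  filter_upwards [h0] with y hy
  rcases eq_or_ne y x with rfl | hyx
  · simp
  · rw [Real.enorm_eq_ofReal (div_nonneg hy (norm_nonneg _)), enorm_inv_eq_ofReal hyx,
      ← ENNReal.ofReal_mul hy, div_eq_mul_inv]

theorem integral_div_norm {σ : Space3 → ℝ} {m : Measure Space3} [NullSingletonClass m]
    (hσ : AEStronglyMeasurable σ m) (h0 : 0 ≤ᵐ[m] σ) (x : Space3) :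
    ∫ y, σ y / ‖x - y‖ ∂m = (∫⁻ y, ENNReal.ofReal (σ y) * ‖x - y‖ₑ⁻¹ ∂m).toReal := by
  have hm : AEStronglyMeasurable (fun y => σ y / ‖x - y‖) m := hσ.div₀ (by fun_prop)
  rw [integral_eq_lintegral_of_nonneg_ae _ hm]
  · congr 1
    refine lintegral_congr_ae ?_
    filter_upwards [h0, m.ae_ne x] with y hy hyx
    rw [enorm_inv_eq_ofReal hyx, ← ENNReal.ofReal_mul hy, div_eq_mul_inv]
  · filter_upwards [h0] with y hy
    exact div_nonneg hy (norm_nonneg _)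

theorem coulombD_self_eq {σ : Space3 → ℝ} (hσ : AEStronglyMeasurable σ) (h0 : 0 ≤ᵐ[volume] σ)
    (hfin : ∀ x, ∫⁻ y, ENNReal.ofReal (σ y) * ‖x - y‖ₑ⁻¹ ≠ ⊤) :
    coulombD σ σ = (1 / 2) * (∫⁻ x, ∫⁻ y,
      ENNReal.ofReal (σ x) * ENNReal.ofReal (σ y) * ‖x - y‖ₑ⁻¹).toReal := by
  have hV : ∀ x, ∫ y, σ x * σ y / ‖x - y‖ =
      σ x * (∫⁻ y, ENNReal.ofReal (σ y) * ‖x - y‖ₑ⁻¹).toReal := fun x => by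
    rw [← integral_div_norm hσ h0, ← integral_const_mul]
    simp only [mul_div_assoc]
  have hm : AEStronglyMeasurable fun x => ∫ y, σ x * σ y / ‖x - y‖ := by
    refine AEStronglyMeasurable.integral_prod_right'
      (f := fun q : Space3 × Space3 => σ q.1 * σ q.2 / ‖q.1 - q.2‖) ?_
    exact (hσ.comp_fst.mul hσ.comp_snd).div₀ (by fun_prop)
  rw [coulombD]
  congr 1
  rw [integral_eq_lintegral_of_nonneg_ae _ hm]
  · congr 1
    refine lintegral_congr_ae ?_
    filter_upwards [h0] with x hx
    simp_rw [mul_assoc]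
    rw [lintegral_const_mul' _ _ ENNReal.ofReal_ne_top, hV, ENNReal.ofReal_mul hx,
      ENNReal.ofReal_toReal (hfin x)]
  · filter_upwards [h0] with x hx
    rw [hV]
    exact mul_nonneg hx ENNReal.toReal_nonneg

theorem lintegral_coulomb_ne_top {σ : Space3 → ℝ} (hσ : Integrable σ) {M : ℝ≥0∞} (hM : M ≠ ⊤)
    (h : ∀ x, ∫⁻ y, ENNReal.ofReal (σ y) * ‖x - y‖ₑ⁻¹ ≤ M) :
    ∫⁻ x, ∫⁻ y, ENNReal.ofReal (σ x) * ENNReal.ofReal (σ y) * ‖x - y‖ₑ⁻¹ ≠ ⊤ := by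
  have hs := hσ.lintegral_lt_top.ne
  refine ne_top_of_le_ne_top (b := (∫⁻ x, ENNReal.ofReal (σ x)) * M) (by finiteness) ?_
  rw [← lintegral_mul_const' _ _ hM]
  refine lintegral_mono fun x => ?_
  simp_rw [mul_assoc]
  rw [lintegral_const_mul' _ _ ENNReal.ofReal_ne_top]
  gcongr
  exact h x

theorem coulombD_mono {ρ ρ' : Space3 → ℝ} (h : ρ ∈ tfDomain) (h' : ρ' ∈ tfDomain)
    (hle : ∀ x, ρ' x ≤ ρ x) : coulombD ρ' ρ' ≤ coulombD ρ ρ := by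
  obtain ⟨M, hM, hb⟩ := exists_coulomb_le h
  obtain ⟨M', hM', hb'⟩ := exists_coulomb_le h'
  rw [coulombD_self_eq h.2.1.1 h.1 fun x => ne_top_of_le_ne_top hM (hb x),
    coulombD_self_eq h'.2.1.1 h'.1 fun x => ne_top_of_le_ne_top hM' (hb' x)]
  gcongr
  · exact lintegral_coulomb_ne_top h.2.1 hM hb
  · exact hle _
  · exact hle _

/-! ### The pointwise bound on the Thomas–Fermi density -/

theorem gammaTF_pos : 0 < gammaTF := by
  have := Real.pi_pos
  unfold gammaTF
  positivity

/-- The density at which the chord slope `(3/5) γ t^{2/3}` of the kinetic energy equals the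
nuclear attraction `Z / |x|`. -/
noncomputable def tfBarrier (Z : ℝ) (x : Space3) : ℝ :=
  (5 * Z / (3 * gammaTF) / ‖x‖) ^ (3 / 2 : ℝ)

/-- Above the barrier, cutting the density down to it strictly lowers the local energy. Only the
monotonicity of `t^{2/3}` is used: `t^{5/3} - b^{5/3} > b^{2/3} (t - b)` for `t > b`. -/
theorem local_energy_lt {Z : ℝ} (hZ : 0 < Z) {x : Space3} (hx : x ≠ 0) {t : ℝ}
    (ht : tfBarrier Z x < t) :
    (3 / 5) * gammaTF * tfBarrier Z x ^ (5 / 3 : ℝ) - Z / ‖x‖ * tfBarrier Z x <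
      (3 / 5) * gammaTF * t ^ (5 / 3 : ℝ) - Z / ‖x‖ * t := by
  have hγ := gammaTF_pos
  have hx' : 0 < ‖x‖ := norm_pos_iff.2 hx
  have hc : 0 < 5 * Z / (3 * gammaTF) / ‖x‖ := by positivity
  set b := tfBarrier Z x with hb
  have hb0 : 0 < b := Real.rpow_pos_of_pos hc _
  have hb23 : b ^ (2 / 3 : ℝ) = 5 * Z / (3 * gammaTF) / ‖x‖ := by
    rw [hb, tfBarrier, ← Real.rpow_mul hc.le]; norm_num
  have hs : ∀ r : ℝ, 0 < r → r ^ (5 / 3 : ℝ) = r * r ^ (2 / 3 : ℝ) := fun r hr => by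
    rw [← Real.rpow_one_add' hr.le (by norm_num)]; norm_num
  have hZb : Z / ‖x‖ = (3 / 5) * gammaTF * b ^ (2 / 3 : ℝ) := by
    rw [hb23]; field_simp
  have ht0 := hb0.trans ht
  have hlt : b ^ (2 / 3 : ℝ) < t ^ (2 / 3 : ℝ) := Real.rpow_lt_rpow hb0.le ht (by norm_num)
  rw [hZb, hs b hb0, hs t ht0]
  have : 0 < (3 / 5) * gammaTF * (t * (t ^ (2 / 3 : ℝ) - b ^ (2 / 3 : ℝ))) :=
    mul_pos (by positivity) (mul_pos ht0 (sub_pos.2 hlt))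
  linarith

theorem measurable_tfBarrier (Z : ℝ) : Measurable (tfBarrier Z) := by
  unfold tfBarrier; fun_prop

theorem integrable_local_energy (Z : ℝ) {ρ : Space3 → ℝ} (h : ρ ∈ tfDomain) :
    Integrable fun x => (3 / 5) * gammaTF * ρ x ^ (5 / 3 : ℝ) - Z / ‖x‖ * ρ x := by
  obtain ⟨M, hM, hb⟩ := exists_coulomb_le h
  have h1 := (integrable_div_norm h.2.1.1 h.1 (ne_top_of_le_ne_top hM (hb 0))).const_mul Z
  refine ((integrable_rpow_of_mem_tfDomain h).const_mul _).sub (h1.congr ?_)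
  filter_upwards with x
  rw [zero_sub, norm_neg]
  ring

/-- The Thomas–Fermi density satisfies `ρ ≤ const (Z / |x|)^{3/2}`: otherwise cutting it down to
this barrier would lower the functional, since the Coulomb repulsion decreases as well. -/
theorem IsTFDensity.ae_le_tfBarrier {Z : ℝ} (hZ : 0 < Z) {ρ : Space3 → ℝ} (h : IsTFDensity Z ρ) :
    ∀ᵐ x, ρ x ≤ tfBarrier Z x := by
  obtain ⟨hρ, hmin⟩ := h
  have hγ := gammaTF_pos
  have hb0 : ∀ x, 0 ≤ tfBarrier Z x := fun x => by unfold tfBarrier; positivity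
  set ρ' : Space3 → ℝ := fun x => min (ρ x) (tfBarrier Z x) with hρ'
  have hm' : AEStronglyMeasurable ρ' :=
    (hρ.2.1.aemeasurable.min (measurable_tfBarrier Z).aemeasurable).aestronglyMeasurable
  have hn : ∀ᵐ x, ‖ρ' x‖ ≤ ‖ρ x‖ := by
    filter_upwards [hρ.1] with x hx
    have hx : 0 ≤ ρ x := hx
    rw [Real.norm_of_nonneg hx, Real.norm_of_nonneg (le_min hx (hb0 x))]
    exact min_le_left _ _
  have hdom : ρ' ∈ tfDomain := by
    refine ⟨?_, hρ.2.1.mono hm' hn, hρ.2.2.mono hm' hn⟩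
    filter_upwards [hρ.1] with x hx
    exact le_min hx (hb0 x)
  have hE : tfFunctional Z ρ ≤ tfFunctional Z ρ' := hmin hdom
  have hD : coulombD ρ' ρ' ≤ coulombD ρ ρ := coulombD_mono hρ hdom fun x => min_le_left _ _
  have hi := integrable_local_energy Z hρ
  have hi' := integrable_local_energy Z hdom
  have hnonneg : 0 ≤ᵐ[volume] fun x =>
      ((3 / 5) * gammaTF * ρ x ^ (5 / 3 : ℝ) - Z / ‖x‖ * ρ x) -
        ((3 / 5) * gammaTF * ρ' x ^ (5 / 3 : ℝ) - Z / ‖x‖ * ρ' x) := by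
    filter_upwards [volume.ae_ne 0] with x hx
    rcases le_or_gt (ρ x) (tfBarrier Z x) with hle | hlt
    · simp [hρ', min_eq_left hle]
    · simp only [hρ', min_eq_right hlt.le, Pi.zero_apply]
      exact (sub_pos.2 (local_energy_lt hZ hx hlt)).le
  have hint : ∫ x, (((3 / 5) * gammaTF * ρ x ^ (5 / 3 : ℝ) - Z / ‖x‖ * ρ x) -
        ((3 / 5) * gammaTF * ρ' x ^ (5 / 3 : ℝ) - Z / ‖x‖ * ρ' x)) = 0 := by
    refine le_antisymm ?_ (integral_nonneg_of_ae hnonneg)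
    rw [integral_sub hi hi']
    unfold tfFunctional at hE
    linarith
  rw [integral_eq_zero_iff_of_nonneg_ae hnonneg (hi.sub hi')] at hint
  filter_upwards [hint, volume.ae_ne 0] with x h0 hx
  by_contra! hlt
  simp only [hρ', min_eq_right hlt.le, Pi.zero_apply] at h0
  exact (sub_pos.2 (local_energy_lt hZ hx hlt)).ne' h0

/-! ### Smearing -/

theorem lintegral_convolution_mul_le {s q k : Space3 → ℝ≥0∞} (hs : AEMeasurable s)
    (hq : AEMeasurable q) (hk : Measurable k) (hq1 : ∫⁻ y, q y = 1) {M : ℝ≥0∞}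
    (hM : ∀ w, ∫⁻ t, s t * k (w - t) ≤ M) (x : Space3) :
    ∫⁻ y, (∫⁻ t, s t * q (y - t)) * k (x - y) ≤ M := by
  -- The integrals do not change when `s` and `q` are replaced by measurable representatives.
  wlog hm : Measurable s ∧ Measurable q generalizing s q
  · have e1 : ∀ y, ∫⁻ t, s t * q (y - t) = ∫⁻ t, hs.mk s t * hq.mk q (y - t) := fun y => by
      have h2 := (quasiMeasurePreserving_sub_left volume y).ae_eq_comp hq.ae_eq_mk
      refine lintegral_congr_ae ?_
      filter_upwards [hs.ae_eq_mk, h2] with t h3 h4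
      simp only [Function.comp_apply] at h4
      rw [← h3, h4]
    simp_rw [e1]
    refine this hs.measurable_mk.aemeasurable hq.measurable_mk.aemeasurable ?_ (fun w => ?_)
      ⟨hs.measurable_mk, hq.measurable_mk⟩
    · rw [← lintegral_congr_ae hq.ae_eq_mk, hq1]
    · refine le_trans (le_of_eq (lintegral_congr_ae ?_)) (hM w)
      filter_upwards [hs.ae_eq_mk] with t ht
      rw [ht]
  obtain ⟨hs, hq⟩ := hm
  calc ∫⁻ y, (∫⁻ t, s t * q (y - t)) * k (x - y)
      = ∫⁻ y, ∫⁻ t, s t * q (y - t) * k (x - y) :=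
        lintegral_congr fun y => (lintegral_mul_const _ (by fun_prop)).symm
    _ = ∫⁻ t, ∫⁻ y, s t * q (y - t) * k (x - y) := lintegral_lintegral_swap (by fun_prop)
    _ = ∫⁻ t, ∫⁻ v, s t * q v * k (x - v - t) := by
        refine lintegral_congr fun t => ?_
        rw [← lintegral_sub_right_eq_self (fun v => s t * q v * k (x - v - t)) t]
        refine lintegral_congr fun y => ?_
        rw [show x - (y - t) - t = x - y by abel]
    _ = ∫⁻ v, ∫⁻ t, s t * q v * k (x - v - t) := lintegral_lintegral_swap (by fun_prop)
    _ = ∫⁻ v, q v * ∫⁻ t, s t * k (x - v - t) := by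
        refine lintegral_congr fun v => ?_
        rw [← lintegral_const_mul _ (by fun_prop)]
        exact lintegral_congr fun t => by ring
    _ ≤ ∫⁻ v, q v * M := by gcongr with v; exact hM _
    _ = M := by rw [lintegral_mul_const _ hq, hq1, one_mul]

theorem integrable_dilate_sq {g : Space3 → ℝ} (hg : MemLp g 2) {R : ℝ} (hR : 0 < R) :
    Integrable fun x => dilate g R x ^ 2 := by
  simp only [dilate, mul_pow]
  exact (hg.integrable_sq.comp_smul (inv_ne_zero hR.ne')).const_mul _

theorem lintegral_dilate_sq {g : Space3 → ℝ} (hg : MemLp g 2) (hg1 : ∫ x, g x ^ 2 = 1) {R : ℝ}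
    (hR : 0 < R) : ∫⁻ x, ENNReal.ofReal (dilate g R x ^ 2) = 1 := by
  rw [← ofReal_integral_eq_lintegral_ofReal (integrable_dilate_sq hg hR)
    (.of_forall fun x => sq_nonneg _)]
  simp only [dilate, mul_pow]
  rw [integral_const_mul, Measure.integral_comp_inv_smul volume (fun x => g x ^ 2) R, hg1,
    finrank_euclideanSpace_fin, abs_of_pos (by positivity), smul_eq_mul, mul_one,
    ← Real.rpow_natCast, ← Real.rpow_natCast, ← Real.rpow_mul hR.le, ← Real.rpow_add hR]
  norm_num

theorem smeared_nonneg {ρ : Space3 → ℝ} (h0 : 0 ≤ᵐ[volume] ρ) (g : Space3 → ℝ) (R : ℝ)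
    (x : Space3) : 0 ≤ smeared ρ g R x := by
  refine integral_nonneg_of_ae ?_
  filter_upwards [h0] with t ht
  exact mul_nonneg ht (sq_nonneg _)

theorem integrable_smeared {ρ g : Space3 → ℝ} (hρ : Integrable ρ) (hg : MemLp g 2) {R : ℝ}
    (hR : 0 < R) : Integrable (smeared ρ g R) :=
  hρ.integrable_convolution (ContinuousLinearMap.mul ℝ ℝ) (integrable_dilate_sq hg hR)

/-- Smearing by a probability density averages translates, so it preserves translation-invariant
bounds on integrals of the density against a kernel. -/
theorem lintegral_smeared_mul_le {ρ g : Space3 → ℝ} (hρ : Integrable ρ) (h0 : 0 ≤ᵐ[volume] ρ)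
    (hg : MemLp g 2) (hg1 : ∫ x, g x ^ 2 = 1) {R : ℝ} (hR : 0 < R) {k : Space3 → ℝ≥0∞}
    (hk : Measurable k) {M : ℝ≥0∞} (hM : ∀ w, ∫⁻ t, ENNReal.ofReal (ρ t) * k (w - t) ≤ M)
    (x : Space3) : ∫⁻ y, ENNReal.ofReal (smeared ρ g R y) * k (x - y) ≤ M := by
  refine le_trans (lintegral_mono fun y => ?_) (lintegral_convolution_mul_le
    hρ.aemeasurable.ennreal_ofReal (integrable_dilate_sq hg hR).aemeasurable.ennreal_ofReal hk
    (lintegral_dilate_sq hg hg1 hR) hM x)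
  gcongr
  rw [← Real.enorm_eq_ofReal (smeared_nonneg h0 g R y)]
  refine (enorm_integral_le_lintegral_enorm _).trans (le_of_eq (lintegral_congr_ae ?_))
  filter_upwards [h0] with t ht
  rw [← ENNReal.ofReal_mul ht, ← Real.enorm_eq_ofReal (mul_nonneg ht (sq_nonneg _))]
  rfl

/-! ### The potential of nearby Thomas–Fermi charge -/

/-- The charge of a Thomas–Fermi density within distance `1/Z` of any point has potential of
order `Z` there. -/
theorem exists_near_bound :
    ∃ B : ℝ, 0 ≤ B ∧ ∀ Z : ℝ, 0 < Z → ∀ ρ, IsTFDensity Z ρ → ∀ x,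
      ∫⁻ y in Metric.ball x Z⁻¹, ENNReal.ofReal (ρ y) * ‖x - y‖ₑ⁻¹ ≤ ENNReal.ofReal (B * Z) := by
  have hγ := gammaTF_pos
  set A : ℝ := (5 / (3 * gammaTF)) ^ (3 / 2 : ℝ)
  have hA0 : 0 ≤ A := by positivity
  refine ⟨A * (2 * singularMass.toReal), by positivity, fun Z hZ ρ hρ x => ?_⟩
  have hb : ∀ y, tfBarrier Z y = A * Z ^ (3 / 2 : ℝ) * ‖y‖ ^ (-(3 / 2) : ℝ) := fun y => by
    rw [tfBarrier, show 5 * Z / (3 * gammaTF) / ‖y‖ = 5 / (3 * gammaTF) * Z * ‖y‖⁻¹ by ring,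
      Real.mul_rpow (by positivity) (by positivity), Real.mul_rpow (by positivity) hZ.le,
      Real.inv_rpow (norm_nonneg _), ← Real.rpow_neg (norm_nonneg _)]
  calc ∫⁻ y in Metric.ball x Z⁻¹, ENNReal.ofReal (ρ y) * ‖x - y‖ₑ⁻¹
      ≤ ∫⁻ y in Metric.ball x Z⁻¹, ENNReal.ofReal (A * Z ^ (3 / 2 : ℝ)) *
          (ENNReal.ofReal (‖y‖ ^ (-(3 / 2) : ℝ)) * ‖x - y‖ₑ⁻¹) := by
        refine lintegral_mono_ae (ae_restrict_of_ae ?_)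
        filter_upwards [hρ.ae_le_tfBarrier hZ] with y hy
        rw [← mul_assoc, ← ENNReal.ofReal_mul (by positivity), ← hb]
        gcongr
    _ ≤ ENNReal.ofReal (A * Z ^ (3 / 2 : ℝ)) *
          (2 * (ENNReal.ofReal (Z⁻¹ ^ (1 / 2 : ℝ)) * singularMass)) := by
        rw [lintegral_const_mul' _ _ ENNReal.ofReal_ne_top]
        gcongr
        exact setLIntegral_ball_coulomb_le x (inv_pos.2 hZ)
    _ = ENNReal.ofReal (A * (2 * singularMass.toReal) * Z) := by
        have hZ1 : Z ^ (3 / 2 : ℝ) * Z⁻¹ ^ (1 / 2 : ℝ) = Z := by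
          rw [Real.inv_rpow hZ.le, ← Real.rpow_neg hZ.le, ← Real.rpow_add hZ]
          norm_num
        rw [← ENNReal.ofReal_toReal singularMass_ne_top, ← ENNReal.ofReal_ofNat 2,
          ← ENNReal.ofReal_mul (by positivity), ← ENNReal.ofReal_mul (by norm_num),
          ← ENNReal.ofReal_mul (by positivity), ENNReal.toReal_ofReal (by positivity)]
        congr 1
        calc _ = A * (2 * singularMass.toReal) * (Z ^ (3 / 2 : ℝ) * Z⁻¹ ^ (1 / 2 : ℝ)) := by ring
          _ = _ := by rw [hZ1]

/-! ### The exchange hole -/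

theorem continuous_setIntegral_ball {σ : Space3 → ℝ} (hσ : Integrable σ) (x : Space3) :
    Continuous fun r : ℝ => ∫ y in Metric.ball x r, σ y := by
  simp_rw [← integral_indicator Metric.isOpen_ball.measurableSet]
  rw [continuous_iff_continuousAt]
  intro r
  refine continuousAt_of_dominated (bound := fun y => ‖σ y‖) (.of_forall fun r =>
    hσ.1.indicator Metric.isOpen_ball.measurableSet) (.of_forall fun r => .of_forall fun y =>
    norm_indicator_le_norm_self _ _) hσ.norm ?_
  have hsph : ∀ᵐ y, y ∉ Metric.sphere x r :=
    measure_eq_zero_iff_ae_notMem.1 (Measure.addHaar_sphere volume x r)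
  filter_upwards [hsph] with y hy
  rcases lt_or_gt_of_ne (show dist y x ≠ r from hy) with h | h
  · refine (continuousAt_const (y := σ y)).congr ?_
    filter_upwards [lt_mem_nhds h] with t ht
    rw [Set.indicator_of_mem (Metric.mem_ball.2 ht)]
  · refine (continuousAt_const (y := (0 : ℝ))).congr ?_
    filter_upwards [gt_mem_nhds h] with t ht
    rw [Set.indicator_of_notMem (by rw [Metric.mem_ball]; exact ht.le.not_gt)]

theorem setOf_edist_lt_ofReal (x : Space3) (r : ℝ) :
    {y | edist x y < ENNReal.ofReal r} = Metric.ball x r := by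
  ext y
  simp only [Set.mem_ofPred_eq, Metric.mem_ball, dist_comm y x, edist_dist]
  exact ENNReal.ofReal_lt_ofReal_iff_of_nonneg dist_nonneg

/-- The exchange hole carries charge at most `1/2`, also when its radius is infinite: the charge of
a ball depends continuously on the radius, so no ball can carry more than `1/2` unless a strictly
smaller one carries exactly `1/2`. -/
theorem setIntegral_exchangeHole_le {σ : Space3 → ℝ} (hσ : Integrable σ) (x : Space3) :
    ∫ y in exchangeHole σ x, σ y ≤ 1 / 2 := by
  have hball : ∀ r : ℝ, 0 ≤ r → ENNReal.ofReal r ≤ holeRadius σ x →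
      ∫ y in Metric.ball x r, σ y ≤ 1 / 2 := by
    intro r hr hle
    by_contra! hgt
    have hmem : (1 / 2 : ℝ) ∈ Set.Icc (∫ y in Metric.ball x (0 : ℝ), σ y)
        (∫ y in Metric.ball x r, σ y) := ⟨by simp, hgt.le⟩
    obtain ⟨t, ht, hteq⟩ :=
      intermediate_value_Icc hr (continuous_setIntegral_ball hσ x).continuousOn hmem
    have htr : t < r := lt_of_le_of_ne ht.2 fun h => by
      rw [← h] at hgt; exact hgt.ne' hteq
    have hsInf : holeRadius σ x ≤ ENNReal.ofReal t := sInf_le (by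
      simp only [Set.mem_ofPred_eq]
      rw [setOf_edist_lt_ofReal]
      exact hteq)
    exact ((ENNReal.ofReal_lt_ofReal_iff_of_nonneg ht.1).2 htr).not_ge (hle.trans hsInf)
  by_cases htop : holeRadius σ x = ⊤
  · have hU : exchangeHole σ x = ⋃ n : ℕ, Metric.ball x (n : ℝ) := by
      rw [Metric.iUnion_ball_nat, exchangeHole, htop]
      ext y
      simp [edist_lt_top]
    rw [hU]
    refine le_of_tendsto' (tendsto_setIntegral_of_monotone
      (fun n => Metric.isOpen_ball.measurableSet) (fun m n h => Metric.ball_subset_ball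
      (by exact_mod_cast h)) hσ.integrableOn) fun n => hball n n.cast_nonneg ?_
    rw [htop]; exact le_top
  · have h := ENNReal.ofReal_toReal htop
    rw [exchangeHole, ← h, setOf_edist_lt_ofReal]
    exact hball _ ENNReal.toReal_nonneg h.le

/-- Split the exchange hole at distance `1/Z` from its centre: farther out the Coulomb kernel is
at most `Z` and the charge at most `1/2`. -/
theorem holePotential_le {σ : Space3 → ℝ} (hσ : Integrable σ) (h0 : ∀ x, 0 ≤ σ x) {B Z : ℝ}
    (hB : 0 ≤ B) (hZ : 0 < Z) {x : Space3}
    (hnear : ∫⁻ y in Metric.ball x Z⁻¹, ENNReal.ofReal (σ y) * ‖x - y‖ₑ⁻¹ ≤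
      ENNReal.ofReal (B * Z)) :
    holePotential σ x ≤ (B + 1) * Z := by
  have hmass : ∫⁻ y in exchangeHole σ x, ENNReal.ofReal (σ y) ≤ 1 := by
    rw [← ofReal_integral_eq_lintegral_ofReal hσ.integrableOn (.of_forall h0)]
    exact ENNReal.ofReal_le_one.2 ((setIntegral_exchangeHole_le hσ x).trans (by norm_num))
  rw [holePotential, integral_div_norm hσ.1.restrict (.of_forall h0)]
  refine ENNReal.toReal_le_of_le_ofReal (by positivity) ?_
  have hpt : ∀ y, ENNReal.ofReal (σ y) * ‖x - y‖ₑ⁻¹ ≤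
      (Metric.ball x Z⁻¹).indicator (fun y => ENNReal.ofReal (σ y) * ‖x - y‖ₑ⁻¹) y +
        ENNReal.ofReal (σ y) * ENNReal.ofReal Z := by
    intro y
    by_cases hy : y ∈ Metric.ball x Z⁻¹
    · rw [Set.indicator_of_mem hy]; exact le_self_add
    · rw [Set.indicator_of_notMem hy, zero_add]
      rw [Metric.mem_ball, dist_comm, dist_eq_norm, not_lt] at hy
      gcongr
      rw [← ofReal_norm, ← ENNReal.ofReal_inv_of_pos ((inv_pos.2 hZ).trans_le hy)]
      exact ENNReal.ofReal_le_ofReal (inv_le_of_inv_le₀ hZ hy)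
  calc ∫⁻ y in exchangeHole σ x, ENNReal.ofReal (σ y) * ‖x - y‖ₑ⁻¹
      ≤ ∫⁻ y in exchangeHole σ x, ((Metric.ball x Z⁻¹).indicator
          (fun y => ENNReal.ofReal (σ y) * ‖x - y‖ₑ⁻¹) y +
        ENNReal.ofReal (σ y) * ENNReal.ofReal Z) := lintegral_mono hpt
    _ = (∫⁻ y in exchangeHole σ x, (Metric.ball x Z⁻¹).indicator
          (fun y => ENNReal.ofReal (σ y) * ‖x - y‖ₑ⁻¹) y) +
        (∫⁻ y in exchangeHole σ x, ENNReal.ofReal (σ y)) * ENNReal.ofReal Z := by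
        rw [lintegral_add_right' _
          (hσ.aemeasurable.ennreal_ofReal.mul_const _).restrict,
          lintegral_mul_const' _ _ ENNReal.ofReal_ne_top]
    _ ≤ ENNReal.ofReal (B * Z) + 1 * ENNReal.ofReal Z := by
        gcongr
        refine (setLIntegral_le_lintegral _ _).trans ?_
        rwa [lintegral_indicator Metric.isOpen_ball.measurableSet]
    _ = ENNReal.ofReal ((B + 1) * Z) := by
        rw [one_mul, ← ENNReal.ofReal_add (by positivity) hZ.le]
        congr 1; ring

/-! ### Bounds for the smeared Thomas–Fermi density -/

/-- The correlation inequality for a density whose potential is locally controlled at the length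
`1/Z`: the cutoff radius `1/(2Z)` makes both the self-energy and the near part of the potential
of order `Z` for each point. -/
theorem exists_correlation_inequality :
    ∃ c : ℝ, 0 ≤ c ∧ ∀ σ : Space3 → ℝ, AEStronglyMeasurable σ → (∀ x, 0 ≤ σ x) →
      (∀ x, ∫⁻ y, ENNReal.ofReal (σ y) * ‖x - y‖ₑ⁻¹ ≠ ⊤) →
      (∫⁻ x, ∫⁻ y, ENNReal.ofReal (σ x) * ENNReal.ofReal (σ y) * ‖x - y‖ₑ⁻¹ ≠ ⊤) →
      ∀ B Z : ℝ, 0 ≤ B → 0 < Z → (∀ x, ∫⁻ y in Metric.ball x Z⁻¹,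
        ENNReal.ofReal (σ y) * ‖x - y‖ₑ⁻¹ ≤ ENNReal.ofReal (B * Z)) →
      ∀ (N : ℕ) (x : Fin N → Space3), Function.Injective x →
        ∑ ν, coulombPotential σ (x ν) ≤
          (∑ ν, ∑ μ ∈ Finset.univ.filter (fun μ => μ < ν), 1 / ‖x μ - x ν‖) +
            coulombD σ σ + (B + c) * N * Z := by
  obtain ⟨c, hc, hcorr⟩ := exists_correlation_bound
  refine ⟨c.toReal, ENNReal.toReal_nonneg, fun σ hσ h0 hV hD B Z hB hZ hnear N x hx => ?_⟩
  have h := hcorr (fun y => ENNReal.ofReal (σ y)) hσ.aemeasurable.ennreal_ofReal (2 * Z)⁻¹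
    (by positivity) N x
  have hpot : ∀ ν, ∫⁻ y, ENNReal.ofReal (σ y) * ‖x ν - y‖ₑ⁻¹ =
      ENNReal.ofReal (coulombPotential σ (x ν)) := fun ν => by
    rw [coulombPotential, integral_div_norm hσ (.of_forall h0), ENNReal.ofReal_toReal (hV _)]
  have hpot0 : ∀ ν, 0 ≤ coulombPotential σ (x ν) := fun ν =>
    integral_nonneg fun y => div_nonneg (h0 y) (norm_nonneg _)
  have hDeq : ∫⁻ x, ∫⁻ y, ENNReal.ofReal (σ x) * ENNReal.ofReal (σ y) * ‖x - y‖ₑ⁻¹ =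
      ENNReal.ofReal (2 * coulombD σ σ) := by
    rw [coulombD_self_eq hσ (.of_forall h0) hV, ← mul_assoc]
    norm_num [ENNReal.ofReal_toReal hD]
  have hD0 : 0 ≤ coulombD σ σ := by
    rw [coulombD_self_eq hσ (.of_forall h0) hV]; positivity
  have hpair : ∀ ν, ∑ μ ∈ Finset.univ.filter (fun μ => μ < ν), ‖x μ - x ν‖ₑ⁻¹ =
      ENNReal.ofReal (∑ μ ∈ Finset.univ.filter (fun μ => μ < ν), 1 / ‖x μ - x ν‖) := fun ν => by
    rw [ENNReal.ofReal_sum_of_nonneg fun μ _ => by positivity]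
    refine Finset.sum_congr rfl fun μ hμ => ?_
    rw [enorm_inv_eq_ofReal (hx.ne (Finset.mem_filter.1 hμ).2.ne'), one_div]
  have hpair0 : ∀ ν, 0 ≤ ∑ μ ∈ Finset.univ.filter (fun μ => μ < ν), 1 / ‖x μ - x ν‖ := fun ν =>
    Finset.sum_nonneg fun μ _ => by positivity
  have hN : ∑ ν, ∫⁻ y in Metric.ball (x ν) (2 * (2 * Z)⁻¹),
      ENNReal.ofReal (σ y) * ‖x ν - y‖ₑ⁻¹ ≤ ENNReal.ofReal (N * (B * Z)) := by
    rw [show 2 * (2 * Z)⁻¹ = Z⁻¹ by field_simp]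
    refine (Finset.sum_le_sum fun ν _ => hnear (x ν)).trans ?_
    simp [ENNReal.ofReal_mul]
  have h2 := h.trans (add_le_add_right (mul_le_mul_right hN 2) _)
  simp_rw [hpot, hpair] at h2
  rw [hDeq, ← ENNReal.ofReal_sum_of_nonneg fun ν _ => hpot0 ν,
    ← ENNReal.ofReal_sum_of_nonneg fun ν _ => hpair0 ν, ← ENNReal.ofReal_toReal hc,
    ← ENNReal.ofReal_natCast N, inv_inv] at h2
  have hP : 0 ≤ ∑ ν, ∑ μ ∈ Finset.univ.filter (fun μ => μ < ν), 1 / ‖x μ - x ν‖ :=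
    Finset.sum_nonneg fun ν _ => hpair0 ν
  have hc0 : 0 ≤ c.toReal := ENNReal.toReal_nonneg
  generalize ∑ ν, ∑ μ ∈ Finset.univ.filter (fun μ => μ < ν), 1 / ‖x μ - x ν‖ = P at h2 hP ⊢
  generalize ∑ ν, coulombPotential σ (x ν) = S at h2 ⊢
  rw [← ENNReal.ofReal_ofNat 2, ← ENNReal.ofReal_mul (by positivity),
    ← ENNReal.ofReal_mul (by positivity), ← ENNReal.ofReal_mul (by positivity),
    ← ENNReal.ofReal_mul (by positivity), ← ENNReal.ofReal_mul (by positivity),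
    ← ENNReal.ofReal_add (by positivity) (by positivity),
    ← ENNReal.ofReal_add (by positivity) (by positivity),
    ← ENNReal.ofReal_add (by positivity) (by positivity),
    ENNReal.ofReal_le_ofReal_iff (by positivity)] at h2
  linarith

theorem lemma5 :
    ∃ k : ℝ, 0 < k ∧
      ∀ (g : Space3 → ℝ), MemLp g 2 → (∫ x, g x ^ 2 = 1) →
      ∀ (δ Z : ℝ), 0 < Z →
      ∀ ρTF : Space3 → ℝ, IsTFDensity Z ρTF →
      ∀ ρδ : Space3 → ℝ, ρδ = smeared ρTF g (Z ^ (-δ)) →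
        (∀ x, IntegrableOn (fun y => ρδ y / ‖x - y‖) (exchangeHole ρδ x)) ∧
        (∀ x, |holePotential ρδ x| ≤ k * Z) ∧
        eLpNorm (holePotential ρδ) ∞ volume ≤ ENNReal.ofReal (k * Z) ∧
        (∀ (N : ℕ) (x : Fin N → Space3), Function.Injective x →
          (∑ ν, coulombPotential ρδ (x ν)) - coulombD ρδ ρδ - k * N * Z ≤
            ∑ ν, ∑ μ ∈ Finset.univ.filter (fun μ => μ < ν), 1 / ‖x μ - x ν‖) := by
  obtain ⟨B, hB, hnear⟩ := exists_near_bound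
  obtain ⟨c, hc, hcorr⟩ := exists_correlation_inequality
  refine ⟨B + c + 1, by positivity, ?_⟩
  rintro g hg hg1 δ Z hZ ρ hρ σ rfl
  have hR : 0 < Z ^ (-δ) := Real.rpow_pos_of_pos hZ _
  obtain ⟨M, hM, hpot⟩ := exists_coulomb_le hρ.1
  have hρ0 := hρ.1.1
  have hρi := hρ.1.2.1
  have hn := hnear Z hZ ρ hρ
  set σ := smeared ρ g (Z ^ (-δ))
  have h0 : ∀ x, 0 ≤ σ x := smeared_nonneg hρ0 g _
  have hσ : Integrable σ := integrable_smeared hρi hg hR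
  have hσpot : ∀ x, ∫⁻ y, ENNReal.ofReal (σ y) * ‖x - y‖ₑ⁻¹ ≤ M :=
    lintegral_smeared_mul_le hρi hρ0 hg hg1 hR (k := fun v => ‖v‖ₑ⁻¹) (by fun_prop) hpot
  have hball : ∀ (f : Space3 → ℝ≥0∞) (x : Space3),
      ∫⁻ y in Metric.ball x Z⁻¹, f y * ‖x - y‖ₑ⁻¹ =
        ∫⁻ y, f y * (Metric.ball (0 : Space3) Z⁻¹).indicator (fun v => ‖v‖ₑ⁻¹) (x - y) := by
    intro f x
    rw [← lintegral_indicator Metric.isOpen_ball.measurableSet]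
    refine lintegral_congr fun y => ?_
    have hmem : x - y ∈ Metric.ball (0 : Space3) Z⁻¹ ↔ y ∈ Metric.ball x Z⁻¹ := by
      rw [mem_ball_zero_iff, Metric.mem_ball, dist_comm, dist_eq_norm]
    by_cases hy : y ∈ Metric.ball x Z⁻¹
    · rw [Set.indicator_of_mem hy, Set.indicator_of_mem (hmem.2 hy)]
    · rw [Set.indicator_of_notMem hy, Set.indicator_of_notMem (mt hmem.1 hy), mul_zero]
  have hσn : ∀ x, ∫⁻ y in Metric.ball x Z⁻¹, ENNReal.ofReal (σ y) * ‖x - y‖ₑ⁻¹ ≤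
      ENNReal.ofReal (B * Z) := by
    intro x
    rw [hball]
    refine lintegral_smeared_mul_le hρi hρ0 hg hg1 hR
      (Measurable.indicator (by fun_prop) Metric.isOpen_ball.measurableSet) (fun w => ?_) x
    rw [← hball]
    exact hn w
  have hσfin : ∀ x, ∫⁻ y, ENNReal.ofReal (σ y) * ‖x - y‖ₑ⁻¹ ≠ ⊤ := fun x =>
    ne_top_of_le_ne_top hM (hσpot x)
  have hhole : ∀ x, |holePotential σ x| ≤ (B + c + 1) * Z := by
    intro x
    have hL0 : 0 ≤ holePotential σ x :=
      integral_nonneg fun y => div_nonneg (h0 y) (norm_nonneg _)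
    rw [abs_of_nonneg hL0]
    refine (holePotential_le hσ h0 hB hZ (hσn x)).trans ?_
    gcongr
    linarith
  refine ⟨fun x => (integrable_div_norm hσ.1 (.of_forall h0) (hσfin x)).integrableOn, hhole, ?_,
    fun N x hx => ?_⟩
  · rw [eLpNorm_exponent_top]
    exact eLpNormEssSup_le_of_ae_bound (.of_forall hhole)
  · have h := hcorr σ hσ.1 h0 hσfin (lintegral_coulomb_ne_top hσ hM hσpot) B Z hB hZ hσn N x hx
    have : 0 ≤ (N : ℝ) * Z := by positivity
    linarith
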